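/- Let $n,p,q,k$ be real numbers with $n\ge 2$, $p>q\ge 1$, $k>0$ and $n<p+q+1$, and let $c\in[kn,\,kn+2\sqrt{p-q})$. Consider the planar autonomous system $$X'=Y,\qquad Y'=cY-knX_+^{\,n-1}Y-X_+^{\,p}+X_+^{\,q},\qquad X_+=\max\{X,0\},$$ where, if $q=1$, the last term $X_+^{\,q}$ is replaced by $X$. Then this system has no limit cycles in $\mathbb{R}^2$; in particular, it has none in the half-plane $\{X>0\}$. Here a cycle is the orbit of a non-constant periodic solution, and a limit cycle is a cycle which is the $\alpha$- or $\omega$-limit set of some trajectory other than itself. -/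

import Mathlib

open Set Filter Topology

/-- The planar vector field `(X, Y) ↦ (Y, c Y - k n X₊^(n-1) Y - X₊^p + X₊^q)` with
`X₊ = max X 0`, where, if `q = 1`, the last term `X₊^q` is replaced by `X`. -/
noncomputable def travelingWaveField (n p q k c : ℝ) (z : ℝ × ℝ) : ℝ × ℝ :=
  (z.2, c * z.2 - k * n * (max z.1 0) ^ (n - 1) * z.2 - (max z.1 0) ^ p
    + (if q = 1 then z.1 else (max z.1 0) ^ q))

/-- A cycle (periodic orbit) of the autonomous planar system `z' = v z`: the orbit of a
non-constant periodic solution. -/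
def IsCycle (v : ℝ × ℝ → ℝ × ℝ) (Γ : Set (ℝ × ℝ)) : Prop :=
  ∃ (γ : ℝ → ℝ × ℝ) (T : ℝ), IsIntegralCurve γ (fun _ => v) ∧ 0 < T ∧ Function.Periodic γ T ∧
    (∃ t, γ t ≠ γ 0) ∧ range γ = Γ

/-- A limit cycle of the autonomous planar system `z' = v z`: a cycle which is the `ω`-limit set
or the `α`-limit set of some trajectory other than the cycle itself. The trajectory has to be
defined only on a forward (respectively backward) half-line of times; its limit set is the set of
its cluster points as `t → ∞` (respectively `t → -∞`). -/
def IsLimitCycle (v : ℝ × ℝ → ℝ × ℝ) (Γ : Set (ℝ × ℝ)) : Prop :=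
  IsCycle v Γ ∧ ∃ η : ℝ → ℝ × ℝ,
    (IsIntegralCurveOn η (fun _ => v) (Ici 0) ∧ (∃ t ∈ Ici (0 : ℝ), η t ∉ Γ) ∧
      {z | MapClusterPt z atTop η} = Γ) ∨
    (IsIntegralCurveOn η (fun _ => v) (Iic 0) ∧ (∃ t ∈ Iic (0 : ℝ), η t ∉ Γ) ∧
      {z | MapClusterPt z atBot η} = Γ)

/-! In fact there is no cycle at all. A periodic solution stays in `X > 0` and avoids equilibria.
There, with `F x = k x ^ n - c x`, `g x = x ^ p - x ^ q` and `w = Y + F X`, the system takes the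
Liénard form `X' = w - F X`, `w' = -g X`. On either side of `X = 1` an arc is a graph over the
`w`-axis, and the potential `G` with `G' = g` satisfies `dG/dw = F - w` along it.

Let `v` be `G` on a left arc minus `G` on the right arc leaving its top, at equal `w`; then `v' =
F_left - F_right`. If `F` is larger on the left whenever `G` is at least as large there, then `v`
strictly increases as long as `v ≥ 0`. But `v = 0` at the top, and `v ≥ 0` at the lower end of the
right arc, where `G` takes its minimum `G 1`: a contradiction (`false_of_profiles`,
`false_of_periodic_lienard`).

The comparison of `F` with `G` is `rpow_damping_lt_of_potential_le`. It rests on the monotonicity of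
`(x ^ s - 1) / (x ^ p - x ^ q)` on `(0, 1)`, where `s = n - 1`, and on the reflection `y ↦ y⁻¹`,
where `n < p + q + 1` enters. -/

/-! ### Arcs as graphs, and successive crossings. -/

/-- A differentiable function with positive derivative on an open interval has a differentiable
inverse. -/
lemma exists_inverse_of_deriv_pos {a b : ℝ} (hab : a < b) {w w' : ℝ → ℝ}
    (hw : ∀ t ∈ Icc a b, HasDerivAt w (w' t) t) (hpos : ∀ t ∈ Ioo a b, 0 < w' t) :
    ∃ σ : ℝ → ℝ, w a < w b ∧ ContinuousOn σ (Icc (w a) (w b)) ∧ σ (w a) = a ∧ σ (w b) = b ∧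
      ∀ y ∈ Ioo (w a) (w b), σ y ∈ Ioo a b ∧ w (σ y) = y ∧ HasDerivAt σ (w' (σ y))⁻¹ y := by
  have hc : ContinuousOn w (Icc a b) := fun t ht => (hw t ht).continuousAt.continuousWithinAt
  have hm : StrictMonoOn w (Icc a b) := by
    refine strictMonoOn_of_deriv_pos (convex_Icc a b) hc fun t ht => ?_
    rw [interior_Icc] at ht
    rw [(hw t (Ioo_subset_Icc_self ht)).deriv]
    exact hpos t ht
  have ha : a ∈ Icc a b := left_mem_Icc.2 hab.le
  have hb : b ∈ Icc a b := right_mem_Icc.2 hab.le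
  have hlt : w a < w b := hm ha hb hab
  have himg : w '' Icc a b = Icc (w a) (w b) := by
    refine Subset.antisymm ?_ (intermediate_value_Icc hab.le hc)
    rintro _ ⟨t, ht, rfl⟩
    exact ⟨hm.monotoneOn ha ht ht.1, hm.monotoneOn ht hb ht.2⟩
  set σ : ℝ → ℝ := Function.invFunOn w (Icc a b) with hσ
  have hleft : ∀ t ∈ Icc a b, σ (w t) = t := fun t ht => hm.injOn.leftInvOn_invFunOn ht
  have hmem : ∀ y ∈ Icc (w a) (w b), σ y ∈ Icc a b ∧ w (σ y) = y := by
    intro y hy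
    rw [← himg] at hy
    exact ⟨Function.invFunOn_mem hy, Function.invFunOn_eq hy⟩
  have hσm : StrictMonoOn σ (Icc (w a) (w b)) := by
    intro y hy z hz hyz
    obtain ⟨h1, h2⟩ := hmem y hy
    obtain ⟨h3, h4⟩ := hmem z hz
    rw [← h2, ← h4] at hyz
    exact (hm.lt_iff_lt h1 h3).1 hyz
  have hσimg : σ '' Icc (w a) (w b) = Icc a b := by
    refine Subset.antisymm ?_ ?_
    · rintro _ ⟨y, hy, rfl⟩
      exact (hmem y hy).1
    · intro t ht
      exact ⟨w t, himg ▸ mem_image_of_mem w ht, hleft t ht⟩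
  have hσc : ContinuousOn σ (Icc (w a) (w b)) := by
    have hsurj : SurjOn σ (Icc (w a) (w b)) (Icc a b) := hσimg.symm.subset
    intro y hy
    rw [ContinuousWithinAt, tendsto_order]
    obtain ⟨h1, h2⟩ := hmem y hy
    constructor
    · intro l hl
      by_cases hla : l < a
      · filter_upwards [self_mem_nhdsWithin] with z hz using hla.trans_le (hmem z hz).1.1
      · have hlm : l ∈ Icc a b := ⟨not_lt.1 hla, hl.le.trans h1.2⟩
        have : w l < y := h2 ▸ hm hlm h1 hl
        filter_upwards [self_mem_nhdsWithin, mem_nhdsWithin_of_mem_nhds (lt_mem_nhds this)]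
          with z hz hz'
        rw [← (hmem z hz).2] at hz'
        exact (hm.lt_iff_lt hlm (hmem z hz).1).1 hz'
    · intro l hl
      by_cases hla : b < l
      · filter_upwards [self_mem_nhdsWithin] with z hz using (hmem z hz).1.2.trans_lt hla
      · have hlm : l ∈ Icc a b := ⟨h1.1.trans hl.le, not_lt.1 hla⟩
        have : y < w l := by
          have := hm h1 hlm hl
          rwa [h2] at this
        filter_upwards [self_mem_nhdsWithin, mem_nhdsWithin_of_mem_nhds (gt_mem_nhds this)]
          with z hz hz'
        rw [← (hmem z hz).2] at hz'
        exact (hm.lt_iff_lt (hmem z hz).1 hlm).1 hz'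
  refine ⟨σ, hlt, hσc, hleft a ha, hleft b hb, fun y hy => ?_⟩
  obtain ⟨h1, h2⟩ := hmem y (Ioo_subset_Icc_self hy)
  have h3 : σ y ∈ Ioo a b := by
    constructor
    · have := hσm (left_mem_Icc.2 hlt.le) (Ioo_subset_Icc_self hy) hy.1
      rwa [hleft a ha] at this
    · have := hσm (Ioo_subset_Icc_self hy) (right_mem_Icc.2 hlt.le) hy.2
      rwa [hleft b hb] at this
  have hnb : Icc (w a) (w b) ∈ 𝓝 y := Icc_mem_nhds hy.1 hy.2
  refine ⟨h3, h2, HasDerivAt.of_local_left_inverse (hσc.continuousAt hnb) (hw _ h1)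
    (hpos _ h3).ne' ?_⟩
  filter_upwards [hnb] with z hz using (hmem z hz).2

/-- An arc of a Liénard system `x' = ε (w - F x)`, `w' = -ε g x` along which `w` increases,
written as a graph over the `w`-axis. -/
lemma exists_profile_of_arc {F g G x w : ℝ → ℝ} {ε a b : ℝ} (hab : a < b)
    (hx : ∀ t ∈ Icc a b, HasDerivAt x (ε * (w t - F (x t))) t)
    (hw : ∀ t ∈ Icc a b, HasDerivAt w (-ε * g (x t)) t)
    (hpos : ∀ t ∈ Ioo a b, 0 < -ε * g (x t))
    (hG : ∀ t ∈ Icc a b, HasDerivAt G (g (x t)) (x t)) :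
    ∃ ξ : ℝ → ℝ, w a < w b ∧ ContinuousOn (fun y => G (ξ y)) (Icc (w a) (w b)) ∧ ξ (w a) = x a ∧
      ξ (w b) = x b ∧ ∀ y ∈ Ioo (w a) (w b), (∃ t ∈ Ioo a b, ξ y = x t) ∧
        HasDerivAt (fun y => G (ξ y)) (F (ξ y) - y) y := by
  obtain ⟨σ, hlt, hc, ha, hb, h⟩ := exists_inverse_of_deriv_pos hab hw hpos
  have hmaps : MapsTo σ (Icc (w a) (w b)) (Icc a b) := by
    intro y hy
    rcases eq_or_lt_of_le hy.1 with h1 | h1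
    · rw [← h1, ha]; exact left_mem_Icc.2 hab.le
    rcases eq_or_lt_of_le hy.2 with h2 | h2
    · rw [h2, hb]; exact right_mem_Icc.2 hab.le
    exact Ioo_subset_Icc_self (h y ⟨h1, h2⟩).1
  refine ⟨fun y => x (σ y), hlt, ?_, by simp [ha], by simp [hb], fun y hy => ?_⟩
  · have : ContinuousOn (fun t => G (x t)) (Icc a b) := fun t ht =>
      ((hG t ht).continuousAt.comp (hx t ht).continuousAt).continuousWithinAt
    exact this.comp hc hmaps
  · obtain ⟨h1, h2, h3⟩ := h y hy
    have h4 := Ioo_subset_Icc_self h1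
    refine ⟨⟨σ y, h1, rfl⟩, ?_⟩
    -- The chain rule gives `g * ε (w - F) / (-ε g)`; both `ε` and `g` cancel, so reversing time
    -- does not change the equation.
    have h5 := ((hG _ h4).comp (σ y) (hx _ h4)).comp y h3
    refine h5.congr_deriv ?_
    have h6 := (hpos _ h1).ne'
    have hε : ε ≠ 0 := by rintro rfl; simp at h6
    have hg : g (x (σ y)) ≠ 0 := by intro h0; simp [h0] at h6
    rw [h2]
    field_simp
    ring

/-- The next zero of a recurrent function after an up-crossing. -/
lemma exists_next_zero {u u' : ℝ → ℝ} (hu : ∀ t, HasDerivAt u (u' t) t) {a T : ℝ} (hT : 0 < T)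
    (ha : u a = 0) (ha' : 0 < u' a) (haT : u (a + T) = 0) :
    ∃ b, a < b ∧ u b = 0 ∧ (∀ t ∈ Ioo a b, 0 < u t) ∧ u' b ≤ 0 := by
  have hcont : Continuous u := continuous_iff_continuousAt.2 fun t => (hu t).continuousAt
  have right_pos : ∀ᶠ t in 𝓝[>] a, 0 < u t := by
    have := (hasDerivAt_iff_tendsto_slope.1 (hu a)).mono_left
      (nhdsWithin_mono a (fun t (ht : a < t) => ht.ne'))
    filter_upwards [this.eventually (lt_mem_nhds ha'), self_mem_nhdsWithin] with t ht hat
    rw [slope_def_field, ha, sub_zero] at ht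
    exact (div_pos_iff_of_pos_right (sub_pos.2 hat)).1 ht
  obtain ⟨d, had, hd⟩ := (mem_nhdsGT_iff_exists_Ioo_subset).1 right_pos
  have had' : a < d := had
  have hdT : d ≤ a + T := by
    by_contra! hlt
    have : 0 < u (a + T) := hd ⟨by linarith, hlt⟩
    linarith
  -- Since `a` is itself a zero, the search for the least later zero starts at `e`, where `u > 0`.
  set e := (a + d) / 2 with he
  have hae : a < e := by rw [he]; linarith
  have hed : e < d := by rw [he]; linarith
  have hue : 0 < u e := hd ⟨hae, hed⟩
  have hK : IsCompact (Icc e (a + T) ∩ u ⁻¹' {0}) :=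
    isCompact_Icc.inter_right (isClosed_singleton.preimage hcont)
  obtain ⟨b, ⟨hbI, hb0⟩, hbl⟩ := hK.exists_isLeast ⟨a + T, ⟨by linarith, le_rfl⟩, haT⟩
  have hb0 : u b = 0 := hb0
  have hpos : ∀ t ∈ Ioo a b, 0 < u t := by
    intro t ht
    by_cases hte : t ≤ e
    · exact hd ⟨ht.1, by linarith⟩
    · push Not at hte
      by_contra! hle
      obtain ⟨r, hr, hr0⟩ := intermediate_value_Icc' hte.le hcont.continuousOn ⟨hle, hue.le⟩
      have := hbl ⟨⟨hr.1, hr.2.trans (ht.2.le.trans hbI.2)⟩, hr0⟩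
      linarith [hr.2, ht.2]
  have hab : a < b := hae.trans_le hbI.1
  refine ⟨b, hab, hb0, hpos, ?_⟩
  have hsl : Tendsto (slope u b) (𝓝[<] b) (𝓝 (u' b)) :=
    (hasDerivAt_iff_tendsto_slope.1 (hu b)).mono_left
      (nhdsWithin_mono b (fun t (ht : t < b) => ht.ne))
  refine le_of_tendsto hsl ?_
  filter_upwards [Ioo_mem_nhdsLT hab] with t ht
  rw [slope_def_field, hb0, sub_zero]
  exact div_nonpos_of_nonneg_of_nonpos (hpos t ht).le (by linarith [ht.2])

/-! ### Comparison of left and right arcs. -/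

lemma strictMonoOn_Ici_one_of_deriv {G g : ℝ → ℝ} (hG : ∀ x, 0 < x → HasDerivAt G (g x) x)
    (hg : ∀ x, 1 < x → 0 < g x) : StrictMonoOn G (Ici 1) := by
  refine strictMonoOn_of_deriv_pos (convex_Ici 1) (fun x hx => ?_) fun x hx => ?_
  · exact (hG x (zero_lt_one.trans_le hx)).continuousAt.continuousWithinAt
  · rw [interior_Ici] at hx
    rw [(hG x (zero_lt_one.trans hx)).deriv]
    exact hg x hx

lemma strictAntiOn_Ioc_one_of_deriv {G g : ℝ → ℝ} (hG : ∀ x, 0 < x → HasDerivAt G (g x) x)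
    (hg : ∀ x, 0 < x → x < 1 → g x < 0) : StrictAntiOn G (Ioc 0 1) := by
  refine strictAntiOn_of_deriv_neg (convex_Ioc 0 1) (fun x hx => ?_) fun x hx => ?_
  · exact (hG x hx.1).continuousAt.continuousWithinAt
  · rw [interior_Ioc] at hx
    rw [(hG x hx.1).deriv]
    exact hg x hx.1 hx.2

/-- Comparison of a left arc and a right arc with the same top point: the right arc cannot end
above the bottom of the left arc. -/
lemma false_of_profiles {F G : ℝ → ℝ} {M : ℝ}
    (A1 : ∀ a b, 0 < a → a < 1 → 1 < b → G b ≤ G a → F b < F a)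
    (A2 : ∃ L, ∀ a b, 0 < a → a < 1 → 1 < b → b ≤ M → G a ≤ G b →
      F b - F a < L * (G b - G a))
    {ξ ζ : ℝ → ℝ} {c d : ℝ} (hcd : c < d)
    (hξ : ContinuousOn (fun y => G (ξ y)) (Icc c d))
    (hζ : ContinuousOn (fun y => G (ζ y)) (Icc c d))
    (hc : G (ζ c) ≤ G (ξ c)) (hd : G (ξ d) = G (ζ d))
    (hξI : ∀ y ∈ Ioo c d, 0 < ξ y ∧ ξ y < 1) (hζI : ∀ y ∈ Ioo c d, 1 < ζ y ∧ ζ y ≤ M)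
    (hξd : ∀ y ∈ Ioo c d, HasDerivAt (fun y => G (ξ y)) (F (ξ y) - y) y)
    (hζd : ∀ y ∈ Ioo c d, HasDerivAt (fun y => G (ζ y)) (F (ζ y) - y) y) : False := by
  obtain ⟨L, hL⟩ := A2
  set v : ℝ → ℝ := fun y => G (ξ y) - G (ζ y) with hv
  have hvc : ContinuousOn v (Icc c d) := hξ.sub hζ
  have hvd : ∀ y ∈ Ioo c d, HasDerivAt v (F (ξ y) - F (ζ y)) y := fun y hy =>
    ((hξd y hy).sub (hζd y hy)).congr_deriv (by ring)
  have hv0 : ∀ y ∈ Icc c d, 0 ≤ v y := by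
    by_contra! hcon
    obtain ⟨y₀, hy₀, hneg⟩ := hcon
    -- At a negative interior minimum of `exp (-L y) * v`, one would have `v' = L v`, whereas `A2`
    -- gives `v' > L v`. The strictness of `A2` is what excludes this.
    have huc : ContinuousOn (fun y => Real.exp (-L * y) * v y) (Icc c d) :=
      ContinuousOn.mul (by fun_prop) hvc
    obtain ⟨y₁, hy₁, hmin⟩ := isCompact_Icc.exists_isMinOn ⟨y₀, hy₀⟩ huc
    have h1 : v y₁ < 0 := by
      have h2 : Real.exp (-L * y₁) * v y₁ ≤ Real.exp (-L * y₀) * v y₀ := hmin hy₀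
      have h3 : Real.exp (-L * y₀) * v y₀ < 0 := mul_neg_of_pos_of_neg (Real.exp_pos _) hneg
      by_contra! h4
      have := mul_nonneg (Real.exp_pos (-L * y₁)).le h4
      linarith
    have hy1 : y₁ ∈ Ioo c d := by
      refine ⟨lt_of_le_of_ne hy₁.1 ?_, lt_of_le_of_ne hy₁.2 ?_⟩
      · rintro rfl
        simp only [hv] at h1
        linarith
      · rintro rfl
        simp only [hv] at h1
        linarith
    have hE : HasDerivAt (fun y => Real.exp (-L * y)) (Real.exp (-L * y₁) * -L) y₁ := by
      simpa using ((hasDerivAt_id y₁).const_mul (-L)).exp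
    have h5 := (hmin.isLocalMin (Icc_mem_nhds hy1.1 hy1.2)).hasDerivAt_eq_zero
      (hE.mul (hvd y₁ hy1))
    have h6 := hL _ _ (hξI y₁ hy1).1 (hξI y₁ hy1).2 (hζI y₁ hy1).1 (hζI y₁ hy1).2
      (by simp only [hv] at h1; linarith)
    have h7 : Real.exp (-L * y₁) * (F (ξ y₁) - F (ζ y₁) - L * v y₁) = 0 := by
      rw [← h5]; ring
    have h8 : 0 < F (ξ y₁) - F (ζ y₁) - L * v y₁ := by
      simp only [hv]; linarith
    exact (mul_pos (Real.exp_pos _) h8).ne' h7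
  have hmono : StrictMonoOn v (Icc c d) := by
    refine strictMonoOn_of_deriv_pos (convex_Icc c d) hvc fun y hy => ?_
    rw [interior_Icc] at hy
    rw [(hvd y hy).deriv]
    have h1 := hv0 y (Ioo_subset_Icc_self hy)
    exact sub_pos.2 (A1 _ _ (hξI y hy).1 (hξI y hy).2 (hζI y hy).1 (by
      simp only [hv] at h1; linarith))
  have := hmono (left_mem_Icc.2 hcd.le) (right_mem_Icc.2 hcd.le) hcd
  simp only [hv] at this
  linarith

/-- A Liénard system whose damping satisfies a strict comparison between points of equal
potential has no periodic orbits in the right half-plane. -/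
theorem false_of_periodic_lienard {F G g x w : ℝ → ℝ} {T : ℝ} (hT : 0 < T)
    (hG : ∀ x, 0 < x → HasDerivAt G (g x) x)
    (hgl : ∀ x, 0 < x → x < 1 → g x < 0) (hgr : ∀ x, 1 < x → 0 < g x)
    (A1 : ∀ a b, 0 < a → a < 1 → 1 < b → G b ≤ G a → F b < F a)
    (A2 : ∀ M, ∃ L, ∀ a b, 0 < a → a < 1 → 1 < b → b ≤ M → G a ≤ G b →
      F b - F a < L * (G b - G a))
    (hx : ∀ t, HasDerivAt x (w t - F (x t)) t) (hw : ∀ t, HasDerivAt w (-g (x t)) t)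
    (hpos : ∀ t, 0 < x t) (hxT : Function.Periodic x T) (hwT : Function.Periodic w T)
    (hne : ∀ t, x t = 1 → w t ≠ F 1) : False := by
  have hxc : Continuous x := continuous_iff_continuousAt.2 fun t => (hx t).continuousAt
  have hwc : Continuous w := continuous_iff_continuousAt.2 fun t => (hw t).continuousAt
  have hx1c : IsClosed {t | x t = 1} := isClosed_singleton.preimage hxc
  have hcross : ∃ t, x t = 1 := by
    by_contra! hcon
    have hside : (∀ t, x t < 1) ∨ ∀ t, 1 < x t := by
      by_contra! hcon'
      obtain ⟨⟨t₁, h1⟩, t₂, h2⟩ := hcon'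
      obtain ⟨t, ht⟩ := mem_range_of_exists_le_of_exists_ge hxc ⟨t₂, h2⟩ ⟨t₁, h1⟩
      exact hcon t ht
    have h0 := hwT 0
    rcases hside with h | h
    · have : StrictMono w := strictMono_of_deriv_pos fun t => by
        rw [(hw t).deriv]; linarith [hgl _ (hpos t) (h t)]
      linarith [this (show (0 : ℝ) < 0 + T by linarith)]
    · have : StrictAnti w := strictAnti_of_deriv_neg fun t => by
        rw [(hw t).deriv]; linarith [hgr _ (h t)]
      linarith [this (show (0 : ℝ) < 0 + T by linarith)]
  have hright : ∀ a, x a = 1 → F 1 < w a →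
      ∃ b, a < b ∧ x b = 1 ∧ (∀ t ∈ Ioo a b, 1 < x t) ∧ w b < F 1 := by
    intro a ha hwa
    obtain ⟨b, hab, hb, hI, hb'⟩ := exists_next_zero (u := fun t => x t - 1)
      (fun t => (hx t).sub_const 1) hT (a := a) (by simp [ha]) (by rw [ha]; linarith)
      (by simp [hxT a, ha])
    have hb : x b = 1 := by linarith
    refine ⟨b, hab, hb, fun t ht => by linarith [hI t ht], lt_of_le_of_ne ?_ (hne b hb)⟩
    rw [hb] at hb'
    linarith
  have hleft : ∀ a, x a = 1 → w a < F 1 →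
      ∃ b, a < b ∧ x b = 1 ∧ (∀ t ∈ Ioo a b, x t < 1) ∧ F 1 < w b := by
    intro a ha hwa
    obtain ⟨b, hab, hb, hI, hb'⟩ := exists_next_zero (u := fun t => 1 - x t)
      (fun t => (hx t).const_sub 1) hT (a := a) (by simp [ha]) (by rw [ha]; linarith)
      (by simp [hxT a, ha])
    have hb : x b = 1 := by linarith
    refine ⟨b, hab, hb, fun t ht => by linarith [hI t ht], lt_of_le_of_ne ?_ (hne b hb).symm⟩
    rw [hb] at hb'
    linarith
  have hdown : ∃ t, x t = 1 ∧ w t ≤ F 1 := by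
    obtain ⟨t, ht⟩ := hcross
    rcases le_or_gt (w t) (F 1) with h | h
    · exact ⟨t, ht, h⟩
    · obtain ⟨b, -, hb, -, hb'⟩ := hright t ht h
      exact ⟨b, hb, hb'.le⟩
  have hreduce : ∀ t, ∃ r ∈ Icc 0 T, x r = x t ∧ w r = w t := by
    intro t
    obtain ⟨r, hr, h⟩ := (show Function.Periodic (fun t => (x t, w t)) T from fun t => by
      simp [hxT t, hwT t]).exists_mem_Ico₀ hT t
    simp only [Prod.mk.injEq] at h
    exact ⟨r, Ico_subset_Icc_self hr, h.1.symm, h.2.symm⟩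
  -- Starting at the lowest downward crossing of `x = 1` forces the next one, `D`, to satisfy `w B ≤
  -- w D`. Thus the left arc spans the heights of the right arc, and the orbit need not close up
  -- after one turn.
  have hK : IsCompact (Icc 0 T ∩ {t | x t = 1 ∧ w t ≤ F 1}) :=
    isCompact_Icc.inter_right (hx1c.inter (isClosed_le hwc continuous_const))
  obtain ⟨B, ⟨-, hB1, hBF⟩, hBmin⟩ := hK.exists_isMinOn (by
    obtain ⟨t, h1, h2⟩ := hdown
    obtain ⟨r, hr, h3, h4⟩ := hreduce t
    exact ⟨r, hr, h3.trans h1, h4.le.trans h2⟩) hwc.continuousOn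
  obtain ⟨C, hBC, hC1, hCI, hCF⟩ := hleft B hB1 (lt_of_le_of_ne hBF (hne B hB1))
  obtain ⟨D, hCD, hD1, hDI, hDF⟩ := hright C hC1 hCF
  have hBD : w B ≤ w D := by
    obtain ⟨r, hr, h3, h4⟩ := hreduce D
    rw [← h4]
    exact hBmin ⟨hr, h3.trans hD1, h4.le.trans hDF.le⟩
  obtain ⟨ξ, -, hξc, hξB, hξC, hξ⟩ := exists_profile_of_arc (F := F) (g := g) (G := G) (x := x)
    (w := w) (ε := 1) hBC (fun t _ => by simpa using hx t) (fun t _ => by simpa using hw t)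
    (fun t ht => by linarith [hgl _ (hpos t) (hCI t ht)]) (fun t _ => hG _ (hpos t))
  -- On the right arc `w` decreases, so time is reversed, with `ε = -1`.
  obtain ⟨ζ, -, hζc, hζD, hζC, hζ⟩ := exists_profile_of_arc (F := F) (g := g) (G := G)
    (x := fun t => x (-t)) (w := fun t => w (-t)) (ε := -1) (neg_lt_neg hCD)
    (fun t _ => by
      simpa [Function.comp_def] using (hx (-t)).comp t (hasDerivAt_neg t))
    (fun t _ => by simpa [Function.comp_def] using (hw (-t)).comp t (hasDerivAt_neg t))
    (fun t ht => by linarith [hgr _ (hDI (-t) ⟨by linarith [ht.2], by linarith [ht.1]⟩)])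
    (fun t _ => hG _ (hpos _))
  simp only [neg_neg] at hζc hζD hζC hζ
  obtain ⟨M, hM⟩ := (isCompact_Icc (a := C) (b := D)).bddAbove_image hxc.continuousOn
  have hG1 : ∀ y, 0 < y → G 1 ≤ G y := by
    intro y hy
    rcases le_total y 1 with h | h
    · exact (strictAntiOn_Ioc_one_of_deriv hG hgl).antitoneOn ⟨hy, h⟩ ⟨one_pos, le_rfl⟩ h
    · exact (strictMonoOn_Ici_one_of_deriv hG hgr).monotoneOn self_mem_Ici h h
  refine false_of_profiles A1 (A2 M) (hDF.trans hCF) (hξc.mono (Icc_subset_Icc_left hBD)) hζc ?_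
    (by rw [hξC, hζC, hC1]) ?_ ?_ (fun y hy => (hξ y ⟨hBD.trans_lt hy.1, hy.2⟩).2)
    (fun y hy => (hζ y hy).2)
  · rw [hζD, hD1]
    refine hG1 _ ?_
    rcases eq_or_lt_of_le hBD with h | h
    · rw [← h, hξB]; exact hpos B
    · obtain ⟨⟨t, -, ht⟩, -⟩ := hξ _ ⟨h, hDF.trans hCF⟩
      rw [ht]; exact hpos t
  · intro y hy
    obtain ⟨⟨t, hI, ht⟩, -⟩ := hξ y ⟨hBD.trans_lt hy.1, hy.2⟩
    rw [ht]
    exact ⟨hpos t, hCI t hI⟩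
  · intro y hy
    obtain ⟨⟨t, hI, ht⟩, -⟩ := hζ y hy
    have hI' : -t ∈ Ioo C D := ⟨by linarith [hI.2], by linarith [hI.1]⟩
    rw [ht]
    exact ⟨hDI _ hI', hM (mem_image_of_mem x (Ioo_subset_Icc_self hI'))⟩

/-! ### Monotone quotients. -/

lemma monotoneOn_sinh_mul_div_sinh_mul {d s : ℝ} (hd : 0 < d) (hds : d ≤ s) :
    MonotoneOn (fun t => Real.sinh (s * t) / Real.sinh (d * t)) (Ioi 0) := by
  have hS : ∀ (r t : ℝ), HasDerivAt (fun t => Real.sinh (r * t)) (Real.cosh (r * t) * r) t :=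
    fun r t => by simpa using ((hasDerivAt_id t).const_mul r).sinh
  have hC : ∀ (r t : ℝ), HasDerivAt (fun t => Real.cosh (r * t)) (Real.sinh (r * t) * r) t :=
    fun r t => by simpa using ((hasDerivAt_id t).const_mul r).cosh
  have hpos : ∀ r t : ℝ, 0 < r → 0 < t → 0 < Real.sinh (r * t) := fun r t hr ht =>
    Real.sinh_pos_iff.2 (mul_pos hr ht)
  have hs : 0 < s := hd.trans_le hds
  -- The numerator of the quotient's derivative: it vanishes at `0`, and its own derivative has the
  -- sign of `s ^ 2 - d ^ 2`.
  set h : ℝ → ℝ := fun t =>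
    Real.cosh (s * t) * s * Real.sinh (d * t) - Real.sinh (s * t) * (Real.cosh (d * t) * d) with hh
  have hmono : MonotoneOn h (Ici 0) := by
    have hder : ∀ t, HasDerivAt h ((s ^ 2 - d ^ 2) * (Real.sinh (s * t) * Real.sinh (d * t))) t :=
      fun t => ((((hC s t).mul_const s).mul (hS d t)).sub
        ((hS s t).mul ((hC d t).mul_const d))).congr_deriv (by ring)
    refine monotoneOn_of_deriv_nonneg (convex_Ici 0)
      (fun t _ => (hder t).continuousAt.continuousWithinAt)
      (fun t _ => (hder t).differentiableAt.differentiableWithinAt) fun t ht => ?_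
    rw [interior_Ici] at ht
    rw [(hder t).deriv]
    exact mul_nonneg (by nlinarith) (mul_pos (hpos s t hs ht) (hpos d t hd ht)).le
  have hder : ∀ t ∈ Ioi (0 : ℝ), HasDerivAt (fun t => Real.sinh (s * t) / Real.sinh (d * t))
      (h t / Real.sinh (d * t) ^ 2) t := fun t ht =>
    (hS s t).div (hS d t) (hpos d t hd ht).ne'
  refine monotoneOn_of_deriv_nonneg (convex_Ioi 0)
    (fun t ht => (hder t ht).continuousAt.continuousWithinAt)
    (fun t ht => (hder t (interior_subset ht)).differentiableAt.differentiableWithinAt)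
    fun t ht => ?_
  rw [interior_Ioi] at ht
  rw [(hder t ht).deriv]
  have h0 : h 0 ≤ h t := hmono self_mem_Ici (mem_Ici_of_Ioi ht) (le_of_lt ht)
  exact div_nonneg (by simpa [hh] using h0) (sq_nonneg _)

lemma monotoneOn_one_sub_exp_div_one_sub_exp {d s : ℝ} (hs : 0 < s) (hsd : s ≤ d) :
    MonotoneOn (fun t => (1 - Real.exp (-s * t)) / (1 - Real.exp (-d * t))) (Ioi 0) := by
  have hE : ∀ (r t : ℝ), HasDerivAt (fun t => Real.exp (r * t)) (Real.exp (r * t) * r) t :=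
    fun r t => by simpa using ((hasDerivAt_id t).const_mul r).exp
  have hd : 0 < d := hs.trans_le hsd
  have hpos : ∀ t, 0 < t → 0 < 1 - Real.exp (-d * t) := fun t ht => by
    have : Real.exp (-d * t) < 1 := Real.exp_lt_one_iff.2 (by nlinarith)
    linarith
  set h : ℝ → ℝ := fun t => s * (Real.exp (d * t) - 1) - d * (Real.exp (s * t) - 1) with hh
  have hmono : MonotoneOn h (Ici 0) := by
    have hder : ∀ t, HasDerivAt h (s * d * (Real.exp (d * t) - Real.exp (s * t))) t :=
      fun t => ((((hE d t).sub_const 1).const_mul s).sub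
        (((hE s t).sub_const 1).const_mul d)).congr_deriv (by ring)
    refine monotoneOn_of_deriv_nonneg (convex_Ici 0)
      (fun t _ => (hder t).continuousAt.continuousWithinAt)
      (fun t _ => (hder t).differentiableAt.differentiableWithinAt) fun t ht => ?_
    rw [interior_Ici] at ht
    rw [(hder t).deriv]
    exact mul_nonneg (by positivity)
      (sub_nonneg.2 (Real.exp_le_exp.2 (mul_le_mul_of_nonneg_right hsd (le_of_lt ht))))
  have hder : ∀ t ∈ Ioi (0 : ℝ),
      HasDerivAt (fun t => (1 - Real.exp (-s * t)) / (1 - Real.exp (-d * t)))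
      (Real.exp (-s * t) * Real.exp (-d * t) * h t / (1 - Real.exp (-d * t)) ^ 2) t := by
    intro t ht
    refine (((hE (-s) t).const_sub 1).div ((hE (-d) t).const_sub 1)
      (hpos t ht).ne').congr_deriv ?_
    congr 1
    have h1 : Real.exp (-s * t) * Real.exp (s * t) = 1 := by rw [← Real.exp_add]; simp
    have h2 : Real.exp (-d * t) * Real.exp (d * t) = 1 := by rw [← Real.exp_add]; simp
    simp only [hh]
    linear_combination Real.exp (-d * t) * d * h1 - Real.exp (-s * t) * s * h2
  refine monotoneOn_of_deriv_nonneg (convex_Ioi 0)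
    (fun t ht => (hder t ht).continuousAt.continuousWithinAt)
    (fun t ht => (hder t (interior_subset ht)).differentiableAt.differentiableWithinAt)
    fun t ht => ?_
  rw [interior_Ioi] at ht
  rw [(hder t ht).deriv]
  have h0 : h 0 ≤ h t := hmono self_mem_Ici (mem_Ici_of_Ioi ht) (le_of_lt ht)
  have h0' : 0 ≤ h t := by simpa [hh] using h0
  exact div_nonneg (by positivity) (sq_nonneg _)

/-- The quotient `(x ^ s - 1) / (x ^ p - x ^ q)` is decreasing on `(0, 1)`. -/
lemma antitoneOn_rpow_sub_one_div {s p q : ℝ} (hs : 0 < s) (hq : 0 ≤ q) (hpq : q < p)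
    (hspq : s ≤ p + q) :
    AntitoneOn (fun x : ℝ => (x ^ s - 1) / (x ^ p - x ^ q)) (Ioo 0 1) := by
  have key : MonotoneOn (fun t : ℝ =>
      (Real.exp (-s * t) - 1) / (Real.exp (-p * t) - Real.exp (-q * t))) (Ioi 0) := by
    have hexp : ∀ r : ℝ, 0 ≤ r → MonotoneOn (fun t => Real.exp (r * t)) (Ioi 0) :=
      fun r hr t _ t' _ h => Real.exp_le_exp.2 (mul_le_mul_of_nonneg_left h hr)
    -- With `x = exp (-t)`, the quotient is `exp (q t)` times a ratio of terms `1 - exp`, or `exp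
    -- ((p + q - s) t / 2)` times a ratio of `sinh`. In each case the matching form is a product of
    -- two nonnegative increasing factors.
    rcases le_total s (p - q) with h | h
    · refine ((hexp q hq).mul (monotoneOn_one_sub_exp_div_one_sub_exp hs h)
        (fun _ _ => (Real.exp_pos _).le) fun t ht => ?_).congr fun t ht => ?_
      · have ht : 0 < t := ht
        exact div_nonneg (sub_nonneg.2 (Real.exp_le_one_iff.2 (by nlinarith)))
          (sub_nonneg.2 (Real.exp_le_one_iff.2 (by nlinarith)))
      · have ht : 0 < t := ht
        have h1 : Real.exp (-p * t) = Real.exp (-q * t) * Real.exp (-(p - q) * t) := by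
          rw [← Real.exp_add]; ring_nf
        have h2 : Real.exp (q * t) = (Real.exp (-q * t))⁻¹ := by
          rw [← Real.exp_neg]; ring_nf
        have h3 : Real.exp (-(p - q) * t) < 1 := Real.exp_lt_one_iff.2 (by nlinarith)
        have h4 : 1 - Real.exp (-(p - q) * t) ≠ 0 := by linarith
        have h5 : Real.exp (-(p - q) * t) - 1 ≠ 0 := by linarith
        have h6 := (Real.exp_pos (-q * t)).ne'
        have h7 : Real.exp (-q * t) * Real.exp (-(p - q) * t) - Real.exp (-q * t) ≠ 0 := by
          rw [← mul_sub_one]; exact mul_ne_zero h6 h5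
        simp only [Pi.mul_apply, h1, h2]
        generalize Real.exp (-q * t) = A at *
        generalize Real.exp (-(p - q) * t) = B at *
        rw [← mul_sub_one, ← neg_sub B 1, ← neg_sub (Real.exp (-s * t)) 1, neg_div_neg_eq]
        field_simp
    · refine ((hexp ((p + q - s) / 2) (by linarith)).mul (monotoneOn_sinh_mul_div_sinh_mul
        (d := (p - q) / 2) (s := s / 2) (by linarith) (by linarith))
        (fun _ _ => (Real.exp_pos _).le) fun t ht => ?_).congr fun t ht => ?_
      · have ht : 0 < t := ht
        exact div_nonneg (Real.sinh_nonneg_iff.2 (by positivity))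
          (Real.sinh_nonneg_iff.2 (mul_nonneg (by linarith) ht.le))
      · have ht : 0 < t := ht
        have h1 : Real.exp (-s * t) - 1
            = -2 * Real.exp (-s / 2 * t) * Real.sinh (s / 2 * t) := by
          rw [Real.sinh_eq]
          have e1 : Real.exp (-s * t) = Real.exp (-s / 2 * t) * Real.exp (-(s / 2 * t)) := by
            rw [← Real.exp_add]; ring_nf
          have e2 : Real.exp (-s / 2 * t) * Real.exp (s / 2 * t) = 1 := by
            rw [← Real.exp_add, ← Real.exp_zero]; ring_nf
          rw [e1]; linear_combination e2
        have h2 : Real.exp (-p * t) - Real.exp (-q * t)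
            = -2 * Real.exp (-(p + q) / 2 * t) * Real.sinh ((p - q) / 2 * t) := by
          rw [Real.sinh_eq]
          have e1 : Real.exp (-p * t)
              = Real.exp (-(p + q) / 2 * t) * Real.exp (-((p - q) / 2 * t)) := by
            rw [← Real.exp_add]; ring_nf
          have e2 : Real.exp (-q * t)
              = Real.exp (-(p + q) / 2 * t) * Real.exp ((p - q) / 2 * t) := by
            rw [← Real.exp_add]; ring_nf
          rw [e1, e2]; ring
        have h3 : Real.exp (-s / 2 * t)
            = Real.exp ((p + q - s) / 2 * t) * Real.exp (-(p + q) / 2 * t) := by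
          rw [← Real.exp_add]; ring_nf
        have h4 : Real.sinh ((p - q) / 2 * t) ≠ 0 :=
          (Real.sinh_pos_iff.2 (mul_pos (by linarith) ht)).ne'
        have h6 := (Real.exp_pos (-(p + q) / 2 * t)).ne'
        simp only [Pi.mul_apply, h1, h2, h3]
        field_simp
  intro x hx y hy hxy
  have hlog : ∀ z ∈ Ioo (0 : ℝ) 1, ∀ r : ℝ, Real.exp (-r * -Real.log z) = z ^ r := fun z hz r => by
    rw [Real.rpow_def_of_pos hz.1]; ring_nf
  have := key (a := -Real.log y) (b := -Real.log x) (neg_pos.2 (Real.log_neg hy.1 hy.2))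
    (neg_pos.2 (Real.log_neg hx.1 hx.2)) (neg_le_neg (Real.log_le_log hx.1 hxy))
  simpa only [hlog x hx, hlog y hy] using this

/-! ### Damping against potential across `x = 1`. -/

lemma rpow_sub_rpow_pos {p q x : ℝ} (hpq : q < p) (hx : 1 < x) : 0 < x ^ p - x ^ q :=
  sub_pos.2 (Real.rpow_lt_rpow_of_exponent_lt hx hpq)

lemma rpow_sub_rpow_neg {p q x : ℝ} (hpq : q < p) (hx : 0 < x) (hx1 : x < 1) :
    x ^ p - x ^ q < 0 :=
  sub_neg.2 (Real.rpow_lt_rpow_of_exponent_gt hx hx1 hpq)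

/-- For `φ x = (x ^ s - 1) / (x ^ p - x ^ q)`, one has `φ y⁻¹ = y ^ (p + q - s) * φ y`, and this
exceeds `φ y` when `y > 1`. -/
lemma rpow_sub_one_lt_div_inv_mul {s p q y : ℝ} (hs : 0 < s) (hpq : q < p) (hspq : s < p + q)
    (hy : 1 < y) :
    y ^ s - 1 < (y⁻¹ ^ s - 1) / (y⁻¹ ^ p - y⁻¹ ^ q) * (y ^ p - y ^ q) := by
  have hy0 : 0 < y := zero_lt_one.trans hy
  have h1 : y ^ s < y ^ p * y ^ q := by
    rw [← Real.rpow_add hy0]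
    exact Real.rpow_lt_rpow_of_exponent_lt hy hspq
  have h2 := rpow_sub_rpow_pos hpq hy
  have h3 : 1 < y ^ s := Real.one_lt_rpow hy hs
  have hP := Real.rpow_pos_of_pos hy0 p
  have hQ := Real.rpow_pos_of_pos hy0 q
  rw [Real.inv_rpow hy0.le, Real.inv_rpow hy0.le, Real.inv_rpow hy0.le]
  generalize y ^ s = a at *
  generalize y ^ p = P at *
  generalize y ^ q = Q at *
  have h4 : (a⁻¹ - 1) / (P⁻¹ - Q⁻¹) * (P - Q) = (a - 1) * (P * Q) / a := by
    have h5 : Q - P ≠ 0 := by linarith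
    have h6 : P⁻¹ - Q⁻¹ = (Q - P) / (P * Q) := by field_simp
    rw [h6]
    field_simp
    ring
  rw [h4, lt_div_iff₀ (by linarith)]
  exact mul_lt_mul_of_pos_left h1 (by linarith)

lemma hasDerivAt_rpow_add_one_div {r x : ℝ} (hr : 0 < r + 1) (hx : 0 < x) :
    HasDerivAt (fun x : ℝ => x ^ (r + 1) / (r + 1)) (x ^ r) x :=
  ((Real.hasDerivAt_rpow_const (Or.inl hx.ne')).div_const (r + 1)).congr_deriv (by
    rw [add_sub_cancel_right]; field_simp)

/-- Points of equal potential `x ^ (p + 1) / (p + 1) - x ^ (q + 1) / (q + 1)` on the two sides of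
`1` are separated by `x ^ (s + 1) / (s + 1) - x`. -/
lemma rpow_damping_lt_of_potential_le {s p q a b : ℝ} (hs : 0 < s) (hq : 0 ≤ q) (hpq : q < p)
    (hspq : s < p + q) (ha : 0 < a) (ha1 : a < 1) (hb : 1 < b)
    (hG : b ^ (p + 1) / (p + 1) - b ^ (q + 1) / (q + 1)
      ≤ a ^ (p + 1) / (p + 1) - a ^ (q + 1) / (q + 1)) :
    b ^ (s + 1) / (s + 1) - b < a ^ (s + 1) / (s + 1) - a := by
  set G : ℝ → ℝ := fun x => x ^ (p + 1) / (p + 1) - x ^ (q + 1) / (q + 1) with hGdef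
  set F : ℝ → ℝ := fun x => x ^ (s + 1) / (s + 1) - x with hFdef
  set f : ℝ → ℝ := fun x => x ^ s - 1 with hf
  set g : ℝ → ℝ := fun x => x ^ p - x ^ q with hg
  change F b < F a
  have hG : G b ≤ G a := hG
  have dG : ∀ x, 0 < x → HasDerivAt G (g x) x := fun x hx =>
    (hasDerivAt_rpow_add_one_div (by linarith) hx).sub (hasDerivAt_rpow_add_one_div (by linarith) hx)
  have dF : ∀ x, 0 < x → HasDerivAt F (f x) x := fun x hx =>
    (hasDerivAt_rpow_add_one_div (by linarith) hx).sub (hasDerivAt_id x)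
  have gneg : ∀ x, 0 < x → x < 1 → g x < 0 := fun x hx hx1 => rpow_sub_rpow_neg hpq hx hx1
  have gpos : ∀ x, 1 < x → 0 < g x := fun x hx => rpow_sub_rpow_pos hpq hx
  have hb0 : 0 < b := zero_lt_one.trans hb
  have dinv : ∀ {H h : ℝ → ℝ}, (∀ x, 0 < x → HasDerivAt H (h x) x) → ∀ y, 0 < y →
      HasDerivAt (fun y => H y - H y⁻¹) (h y + h y⁻¹ / y ^ 2) y := by
    intro H h hH y hy
    refine ((hH y hy).sub ((hH y⁻¹ (inv_pos.2 hy)).comp y (hasDerivAt_inv hy.ne'))).congr_deriv ?_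
    ring
  have hgsum : ∀ y, 1 < y → 0 < g y + g y⁻¹ / y ^ 2 := by
    intro y hy
    have hy0 : 0 < y := zero_lt_one.trans hy
    have h1 : 1 < y ^ p * y ^ q := by
      rw [← Real.rpow_add hy0]
      exact Real.one_lt_rpow hy (by linarith)
    have h2 : g y + g y⁻¹ / y ^ 2 = g y * (1 - 1 / (y ^ p * y ^ q * y ^ 2)) := by
      simp only [hg]
      rw [Real.inv_rpow hy0.le, Real.inv_rpow hy0.le]
      have hP := (Real.rpow_pos_of_pos hy0 p).ne'
      have hQ := (Real.rpow_pos_of_pos hy0 q).ne'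
      field_simp
      ring
    rw [h2]
    refine mul_pos (gpos y hy) (sub_pos.2 ?_)
    have h3 : 1 < y ^ 2 := by nlinarith
    rw [div_lt_one (by nlinarith)]
    nlinarith
  have hbI : ∀ y, 1 < y → y⁻¹ ∈ Ioo (0 : ℝ) 1 := fun y hy =>
    ⟨inv_pos.2 (zero_lt_one.trans hy), inv_lt_one_of_one_lt₀ hy⟩
  set φ : ℝ → ℝ := fun x => f x / g x with hφ
  have hφg : ∀ x ∈ Ioo (0 : ℝ) 1, φ x * g x = f x := fun x hx =>
    div_mul_cancel₀ _ (gneg x hx.1 hx.2).ne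
  have hanti : AntitoneOn φ (Ioo 0 1) := antitoneOn_rpow_sub_one_div hs hq hpq hspq.le
  set α : ℝ := φ b⁻¹ with hα
  have hαpos : 0 ≤ α := div_nonneg_of_nonpos
    (sub_nonpos.2 (Real.rpow_le_one (hbI b hb).1.le (hbI b hb).2.le hs.le))
    (gneg _ (hbI b hb).1 (hbI b hb).2).le
  -- First leg, from `b` to its reflection: differentiating in `y`, the ratio of the two increments
  -- is controlled by `φ y⁻¹ ≤ φ b⁻¹ = α`.
  have hstep : F b - F b⁻¹ < α * (G b - G b⁻¹) := by
    have dQ : ∀ y, 0 < y → HasDerivAt (fun y => (F y - F y⁻¹) - α * (G y - G y⁻¹))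
        (f y + f y⁻¹ / y ^ 2 - α * (g y + g y⁻¹ / y ^ 2)) y := fun y hy =>
      (dinv dF y hy).sub ((dinv dG y hy).const_mul α)
    have hQ : StrictAntiOn (fun y => (F y - F y⁻¹) - α * (G y - G y⁻¹)) (Icc 1 b) := by
      refine strictAntiOn_of_deriv_neg (convex_Icc 1 b)
        (fun y hy => (dQ y (zero_lt_one.trans_le hy.1)).continuousAt.continuousWithinAt)
        fun y hy => ?_
      rw [interior_Icc] at hy
      have hy0 : 0 < y := zero_lt_one.trans hy.1
      rw [(dQ y hy0).deriv]
      have h1 : f y < φ y⁻¹ * g y := rpow_sub_one_lt_div_inv_mul hs hpq hspq hy.1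
      have h2 : φ y⁻¹ ≤ α := hanti (hbI b hb) (hbI y hy.1)
        (inv_anti₀ hy0 hy.2.le)
      have h3 := mul_le_mul_of_nonneg_right h2 (hgsum y hy.1).le
      rw [← hφg _ (hbI y hy.1)]
      have h4 : φ y⁻¹ * (g y + g y⁻¹ / y ^ 2) = φ y⁻¹ * g y + φ y⁻¹ * g y⁻¹ / y ^ 2 := by ring
      linarith
    have := hQ (left_mem_Icc.2 hb.le) (right_mem_Icc.2 hb.le) hb
    simp only [inv_one, sub_self, mul_zero] at this
    linarith
  -- Because `G b⁻¹ < G b ≤ G a` and `G` decreases on `(0, 1]`.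
  have hab : a < b⁻¹ := by
    by_contra! hle
    have h1 : G a ≤ G b⁻¹ := (strictAntiOn_Ioc_one_of_deriv dG gneg).antitoneOn
      ⟨(hbI b hb).1, (hbI b hb).2.le⟩ ⟨ha, ha1.le⟩ hle
    have h2 : StrictMonoOn (fun y => G y - G y⁻¹) (Ici 1) := by
      refine strictMonoOn_of_deriv_pos (convex_Ici 1)
        (fun y hy => (dinv dG y (zero_lt_one.trans_le hy)).continuousAt.continuousWithinAt)
        fun y hy => ?_
      rw [interior_Ici] at hy
      rw [(dinv dG y (zero_lt_one.trans hy)).deriv]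
      exact hgsum y hy
    have := h2 self_mem_Ici hb.le hb
    simp only [inv_one, sub_self] at this
    linarith
  -- Second leg, from `b⁻¹` down to `a`: here `f - α g = (φ - α) g ≤ 0`. Adding the legs leaves `F b
  -- - F a < α (G b - G a) ≤ 0`.
  have hlast : F b⁻¹ - α * G b⁻¹ ≤ F a - α * G a := by
    have dR : ∀ y, 0 < y → HasDerivAt (fun y => F y - α * G y) (f y - α * g y) y := fun y hy =>
      (dF y hy).sub ((dG y hy).const_mul α)
    have hR : AntitoneOn (fun y => F y - α * G y) (Icc a b⁻¹) := by
      refine antitoneOn_of_deriv_nonpos (convex_Icc _ _)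
        (fun y hy => (dR y (ha.trans_le hy.1)).continuousAt.continuousWithinAt)
        (fun y hy => ?_) fun y hy => ?_
      · exact (dR y (ha.trans_le (interior_subset hy).1)).differentiableAt.differentiableWithinAt
      · rw [interior_Icc] at hy
        have hy0 : 0 < y := ha.trans hy.1
        have hyI : y ∈ Ioo (0 : ℝ) 1 := ⟨hy0, hy.2.trans (hbI b hb).2⟩
        rw [(dR y hy0).deriv, ← hφg y hyI]
        have h2 : α ≤ φ y := hanti hyI (hbI b hb) hy.2.le
        nlinarith [gneg y hyI.1 hyI.2]
    exact hR (left_mem_Icc.2 hab.le) (right_mem_Icc.2 hab.le) hab.le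
  nlinarith [mul_le_mul_of_nonneg_left hG hαpos]

/-- Both sides vanish to first order at `1`, so each is compared with `log x`: the left from above
by `s * M ^ s * log x`, the right from below by `(p - q) * log x`. -/
lemma exists_rpow_sub_one_le {s p q : ℝ} (hs : 0 < s) (hq : 0 ≤ q) (hpq : q < p) (M : ℝ) :
    ∃ K, 0 ≤ K ∧ ∀ x, 1 ≤ x → x ≤ M → x ^ s - 1 ≤ K * (x ^ p - x ^ q) := by
  rcases lt_or_ge M 1 with hM | hM
  · exact ⟨0, le_rfl, fun x h1 h2 => by linarith⟩
  have hd : 0 < p - q := by linarith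
  have hMs : 0 ≤ M ^ s := Real.rpow_nonneg (by linarith) s
  refine ⟨s * M ^ s / (p - q), by positivity, fun x h1 h2 => ?_⟩
  have hx : 0 < x := by linarith
  have hl : 0 ≤ Real.log x := Real.log_nonneg h1
  have h3 : x ^ s - 1 ≤ s * M ^ s * Real.log x := by
    have e1 : x ^ s * Real.exp (-(Real.log x * s)) = 1 := by
      rw [Real.rpow_def_of_pos hx, ← Real.exp_add]; simp
    have e2 := Real.add_one_le_exp (-(Real.log x * s))
    have e3 : x ^ s ≤ M ^ s := Real.rpow_le_rpow hx.le h2 hs.le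
    have e4 := mul_le_mul_of_nonneg_left e2 (Real.rpow_pos_of_pos hx s).le
    have e5 := mul_le_mul_of_nonneg_right e3 (mul_nonneg hl hs.le)
    nlinarith
  have h4 : (p - q) * Real.log x ≤ x ^ p - x ^ q := by
    have e1 : x ^ p = x ^ q * x ^ (p - q) := by rw [← Real.rpow_add hx]; ring_nf
    have e2 : Real.log x * (p - q) + 1 ≤ x ^ (p - q) := by
      rw [Real.rpow_def_of_pos hx]; exact Real.add_one_le_exp _
    have e3 : 1 ≤ x ^ q := Real.one_le_rpow h1 hq
    rw [e1]
    nlinarith [mul_nonneg hl hd.le]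
  refine h3.trans ?_
  rw [div_mul_eq_mul_div, le_div_iff₀ hd]
  have := mul_le_mul_of_nonneg_left h4 (mul_nonneg hs.le hMs)
  linarith

/-- The derivative of `k x ^ n - c x` is dominated by the force on bounded subsets of `[1, ∞)`, so
the strict damping comparison of `rpow_damping_lt_of_potential_le` extends to points of unequal
potential. -/
lemma lienard_damping_comparison {n p q k c : ℝ} (hn : 1 < n) (hq : 0 ≤ q) (hpq : q < p)
    (hk : 0 < k) (hnpq : n < p + q + 1) (hc : k * n ≤ c) {F G : ℝ → ℝ}
    (hF : ∀ x, F x = k * x ^ n - c * x)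
    (hG : ∀ x, G x = x ^ (p + 1) / (p + 1) - x ^ (q + 1) / (q + 1)) :
    (∀ a b, 0 < a → a < 1 → 1 < b → G b ≤ G a → F b < F a) ∧
    ∀ M, ∃ L, ∀ a b, 0 < a → a < 1 → 1 < b → b ≤ M → G a ≤ G b →
      F b - F a < L * (G b - G a) := by
  have hkn : 0 < k * n := mul_pos hk (by linarith)
  have dG : ∀ x, 0 < x → HasDerivAt G (x ^ p - x ^ q) x := fun x hx => by
    rw [funext hG]
    exact (hasDerivAt_rpow_add_one_div (by linarith) hx).sub
      (hasDerivAt_rpow_add_one_div (by linarith) hx)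
  have dF : ∀ x, 0 < x → HasDerivAt F (k * n * x ^ (n - 1) - c) x := fun x hx => by
    rw [funext hF]
    exact (((Real.hasDerivAt_rpow_const (Or.inl hx.ne')).const_mul k).sub
      ((hasDerivAt_id x).const_mul c)).congr_deriv (by ring)
  have A1 : ∀ a b, 0 < a → a < 1 → 1 < b → G b ≤ G a → F b < F a := by
    intro a b ha ha1 hb h
    rw [hG, hG] at h
    have h1 := rpow_damping_lt_of_potential_le (s := n - 1) (by linarith) hq hpq (by linarith)
      ha ha1 hb h
    rw [sub_add_cancel] at h1
    have h2 := mul_lt_mul_of_pos_left h1 hkn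
    have e : ∀ x : ℝ, k * n * (x ^ n / n - x) = k * x ^ n - k * n * x := fun x => by
      field_simp
    rw [e, e] at h2
    rw [hF, hF]
    -- The remaining part of `F` is `-(c - k n) x`, which is nonincreasing and so only helps, as `a
    -- < b`.
    nlinarith
  refine ⟨A1, fun M => ?_⟩
  obtain ⟨K, hK, hKf⟩ := exists_rpow_sub_one_le (s := n - 1) (by linarith) hq hpq M
  refine ⟨k * n * K, fun a b ha ha1 hb hbM h => ?_⟩
  have mG := strictMonoOn_Ici_one_of_deriv dG fun x hx => rpow_sub_rpow_pos hpq hx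
  have aG := strictAntiOn_Ioc_one_of_deriv dG fun x hx hx1 => rpow_sub_rpow_neg hpq hx hx1
  have h1a : G 1 < G a := aG ⟨ha, ha1.le⟩ ⟨one_pos, le_rfl⟩ ha1
  -- Take `b'` on the right at the potential of `a`: `A1` settles the pair `a, b'` strictly, and the
  -- bound `f ≤ K g` carries `b'` to `b`.
  obtain ⟨b', hb', hGb'⟩ := intermediate_value_Icc hb.le
    (fun x hx => (dG x (one_pos.trans_le hx.1)).continuousAt.continuousWithinAt) ⟨h1a.le, h⟩
  have h1b' : 1 < b' := lt_of_le_of_ne hb'.1 (by rintro rfl; linarith)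
  have hlt := A1 a b' ha ha1 h1b' hGb'.le
  have dR : ∀ y, 0 < y → HasDerivAt (fun y => F y - k * n * K * G y)
      (k * n * y ^ (n - 1) - c - k * n * K * (y ^ p - y ^ q)) y := fun y hy =>
    (dF y hy).sub ((dG y hy).const_mul _)
  have hR : AntitoneOn (fun y => F y - k * n * K * G y) (Icc 1 b) := by
    refine antitoneOn_of_deriv_nonpos (convex_Icc _ _)
      (fun y hy => (dR y (one_pos.trans_le hy.1)).continuousAt.continuousWithinAt)
      (fun y hy => ?_) fun y hy => ?_
    · exact (dR y (one_pos.trans_le (interior_subset hy).1)).differentiableAt.differentiableWithinAt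
    · rw [interior_Icc] at hy
      rw [(dR y (one_pos.trans hy.1)).deriv]
      have := mul_le_mul_of_nonneg_left (hKf y hy.1.le (hy.2.le.trans hbM)) hkn.le
      linarith
  have := hR hb' (right_mem_Icc.2 hb.le) hb'.2
  simp only [hGb'] at this
  linarith

/-! ### Equilibria, positivity and the Liénard form. -/

lemma exists_abs_max_rpow_sub_le {r : ℝ} (hr : 1 ≤ r) (R : ℝ) :
    ∃ K, 0 ≤ K ∧ ∀ x m : ℝ, |x| ≤ R → |m| ≤ R →
      |(max x 0) ^ r - (max m 0) ^ r| ≤ K * |x - m| := by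
  rcases lt_or_ge R 0 with hR | hR
  · exact ⟨0, le_rfl, fun x _ hx _ => absurd (abs_nonneg x) (by linarith)⟩
  have hK : 0 ≤ r * R ^ (r - 1) := mul_nonneg (by linarith) (Real.rpow_nonneg hR _)
  refine ⟨r * R ^ (r - 1), hK, fun x m hx hm => ?_⟩
  have hmem : ∀ z : ℝ, |z| ≤ R → max z 0 ∈ Icc 0 R := fun z hz =>
    ⟨le_max_right _ _, max_le ((le_abs_self z).trans hz) hR⟩
  have h := (convex_Icc 0 R).norm_image_sub_le_of_norm_hasDerivWithin_le
    (f := fun z : ℝ => z ^ r) (f' := fun z => r * z ^ (r - 1)) (C := r * R ^ (r - 1))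
    (fun z _ => (Real.hasDerivAt_rpow_const (Or.inr hr)).hasDerivWithinAt)
    (fun z hz => by
      rw [Real.norm_of_nonneg (mul_nonneg (by linarith) (Real.rpow_nonneg hz.1 _))]
      exact mul_le_mul_of_nonneg_left (Real.rpow_le_rpow hz.1 hz.2 (by linarith)) (by linarith))
    (hmem m hm) (hmem x hx)
  rw [Real.norm_eq_abs, Real.norm_eq_abs] at h
  exact h.trans (mul_le_mul_of_nonneg_left
    (abs_max_sub_max_le_abs x m 0) hK)

/-- Near an equilibrium the field grows at most linearly, uniformly on bounded sets. -/
lemma exists_norm_travelingWaveField_le {n p q k c : ℝ} (hn : 2 ≤ n) (hq : 1 ≤ q) (hpq : q < p)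
    {m : ℝ} (hm : travelingWaveField n p q k c (m, 0) = 0) (R : ℝ) (hmR : |m| ≤ R) :
    ∃ K, ∀ z : ℝ × ℝ, |z.1| ≤ R → ‖travelingWaveField n p q k c z‖ ≤ K * ‖z - (m, 0)‖ := by
  obtain ⟨K₁, hK₁, h₁⟩ := exists_abs_max_rpow_sub_le (r := n - 1) (by linarith) R
  obtain ⟨K₂, hK₂, h₂⟩ := exists_abs_max_rpow_sub_le (r := p) (by linarith) R
  obtain ⟨K₃, hK₃, h₃⟩ := exists_abs_max_rpow_sub_le (r := q) hq R
  have hR : 0 ≤ R := (abs_nonneg m).trans hmR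
  set B := |c| + |k * n| * (K₁ * R) with hB
  have hB0 : 0 ≤ B := by positivity
  refine ⟨1 + B + K₂ + (1 + K₃), fun z hz => ?_⟩
  obtain ⟨x, y⟩ := z
  have hm2 : -(max m 0) ^ p + (if q = 1 then m else (max m 0) ^ q) = 0 := by
    have := congrArg Prod.snd hm
    simpa [travelingWaveField] using this
  set N := ‖((x, y) : ℝ × ℝ) - (m, 0)‖ with hN
  have hxN : |x - m| ≤ N := norm_fst_le (((x, y) : ℝ × ℝ) - (m, 0))
  have hyN : |y| ≤ N := by
    rw [← sub_zero y]
    exact norm_snd_le (((x, y) : ℝ × ℝ) - (m, 0))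
  have hN0 : 0 ≤ N := norm_nonneg _
  have hx : |x| ≤ R := hz
  have e1 : |(max x 0) ^ (n - 1)| ≤ K₁ * R := by
    have := h₁ x 0 hx (by simpa using hR)
    rw [max_self, Real.zero_rpow (by linarith), sub_zero, sub_zero] at this
    exact this.trans (mul_le_mul_of_nonneg_left hx hK₁)
  have e2 : |(c - k * n * (max x 0) ^ (n - 1)) * y| ≤ B * N := by
    rw [abs_mul]
    refine mul_le_mul ((abs_sub _ _).trans ?_) hyN (abs_nonneg _) hB0
    rw [abs_mul]
    exact add_le_add_right (mul_le_mul_of_nonneg_left e1 (abs_nonneg _)) _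
  have e3 : |(max m 0) ^ p - (max x 0) ^ p| ≤ K₂ * N := by
    rw [abs_sub_comm]
    exact (h₂ x m hx hmR).trans (mul_le_mul_of_nonneg_left hxN hK₂)
  have e4 : |(if q = 1 then x else (max x 0) ^ q) - (if q = 1 then m else (max m 0) ^ q)|
      ≤ (1 + K₃) * N := by
    split_ifs
    · nlinarith
    · have := (h₃ x m hx hmR).trans (mul_le_mul_of_nonneg_left hxN hK₃)
      linarith
  have e5 : c * y - k * n * (max x 0) ^ (n - 1) * y - (max x 0) ^ p
      + (if q = 1 then x else (max x 0) ^ q)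
      = (c - k * n * (max x 0) ^ (n - 1)) * y + ((max m 0) ^ p - (max x 0) ^ p)
      + ((if q = 1 then x else (max x 0) ^ q) - (if q = 1 then m else (max m 0) ^ q)) := by
    linear_combination hm2
  refine norm_prod_le_iff.2 ⟨?_, ?_⟩
  · change |y| ≤ _
    nlinarith [mul_nonneg hB0 hN0, mul_nonneg hK₂ hN0, mul_nonneg hK₃ hN0]
  · change |c * y - k * n * (max x 0) ^ (n - 1) * y - (max x 0) ^ p
      + (if q = 1 then x else (max x 0) ^ q)| ≤ _
    rw [e5]
    refine (abs_add_three _ _ _).trans ?_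
    linarith

theorem not_isCycle_travelingWaveField {n p q k c : ℝ} (hn : 2 ≤ n) (hq : 1 ≤ q) (hpq : q < p)
    (hk : 0 < k) (hnpq : n < p + q + 1) (hc : k * n ≤ c) (Γ : Set (ℝ × ℝ)) :
    ¬ IsCycle (travelingWaveField n p q k c) Γ := by
  rintro ⟨γ, T, hγ, hT, hper, ⟨t₁, ht₁⟩, -⟩
  have hγd : ∀ t, HasDerivAt γ (travelingWaveField n p q k c (γ t)) t := hγ
  set X : ℝ → ℝ := fun t => (γ t).1 with hXdef
  set Y : ℝ → ℝ := fun t => (γ t).2 with hYdef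
  have hX : ∀ t, HasDerivAt X (Y t) t := fun t => (hγd t).fst
  have hY : ∀ t, HasDerivAt Y (c * Y t - k * n * (max (X t) 0) ^ (n - 1) * Y t
      - (max (X t) 0) ^ p + (if q = 1 then X t else (max (X t) 0) ^ q)) t := fun t => (hγd t).snd
  have hXc : Continuous X := continuous_iff_continuousAt.2 fun t => (hX t).continuousAt
  have hXT : Function.Periodic X T := fun t => by simp only [hXdef, hper t]
  have hYT : Function.Periodic Y T := fun t => by simp only [hYdef, hper t]
  have hne : ∀ t m, travelingWaveField n p q k c (m, 0) = 0 → γ t ≠ (m, 0) := by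
    intro t₀ m hm h0
    obtain ⟨R, hR⟩ := isBounded_iff_forall_norm_le.1
      (hXT.isBounded_of_continuous hT.ne' hXc)
    have hR : ∀ t, |X t| ≤ R := fun t => hR _ (mem_range_self t)
    have hmR : |m| ≤ R := by simpa [hXdef, h0] using hR t₀
    obtain ⟨K, hK⟩ := exists_norm_travelingWaveField_le hn hq hpq hm R hmR
    -- Grönwall keeps the solution at the equilibrium forward in time; periodicity then covers all
    -- times.
    have hconst : ∀ t, t₀ ≤ t → γ t = (m, 0) := by
      intro t ht
      have := norm_le_gronwallBound_of_norm_deriv_right_le (f := fun t => γ t - (m, 0))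
        (δ := 0) (K := K) (ε := 0) (a := t₀) (b := t)
        (fun s _ => ((hγd s).sub_const _).continuousAt.continuousWithinAt)
        (fun s _ => ((hγd s).sub_const _).hasDerivWithinAt)
        (by simp [h0]) (fun s _ => by simpa using hK _ (hR s)) t ⟨ht, le_rfl⟩
      rw [gronwallBound_ε0_δ0] at this
      exact sub_eq_zero.1 (norm_le_zero_iff.1 this)
    have hall : ∀ t, γ t = (m, 0) := by
      intro t
      obtain ⟨r, hr, h⟩ := hper.exists_mem_Ico hT t t₀
      rw [h]
      exact hconst r hr.1
    exact ht₁ ((hall t₁).trans (hall 0).symm)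
  have hpos : ∀ t, 0 < X t := by
    obtain ⟨t₀, -, hmin⟩ := isCompact_Icc.exists_isMinOn (nonempty_Icc.2 hT.le) hXc.continuousOn
    have hmin' : ∀ t, X t₀ ≤ X t := by
      intro t
      obtain ⟨r, hr, h⟩ := hXT.exists_mem_Ico₀ hT t
      rw [h]
      exact hmin (Ico_subset_Icc_self hr)
    have hY0 : Y t₀ = 0 :=
      IsLocalMin.hasDerivAt_eq_zero (Eventually.of_forall hmin') (hX t₀)
    suffices h : 0 < X t₀ from fun t => h.trans_le (hmin' t)
    by_contra! hle
    have hmax : max (X t₀) 0 = 0 := max_eq_right hle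
    have hp0 : p ≠ 0 := by linarith
    have hq0 : q ≠ 0 := by linarith
    -- If `q = 1` and the minimum of `X` is negative, then `Y' = X < 0` there, so `X` would drop
    -- below its minimum. Otherwise `(X t₀, 0)` is an equilibrium.
    by_cases hcase : q = 1 ∧ X t₀ < 0
    · obtain ⟨hq1, hneg⟩ := hcase
      obtain ⟨b, hab, -, hI, -⟩ := exists_next_zero (u := fun t => -Y t)
        (fun t => (hY t).neg) hT (a := t₀) (by simp [hY0])
        (by rw [hmax, hY0, if_pos hq1, Real.zero_rpow hp0]; linarith) (by simp [hYT t₀, hY0])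
      have : StrictAntiOn X (Icc t₀ b) := by
        refine strictAntiOn_of_deriv_neg (convex_Icc _ _) hXc.continuousOn fun t ht => ?_
        rw [interior_Icc] at ht
        rw [(hX t).deriv]
        linarith [hI t ht]
      linarith [hmin' b, this (left_mem_Icc.2 hab.le) (right_mem_Icc.2 hab.le) hab]
    · refine hne t₀ (X t₀) ?_ (Prod.ext rfl hY0)
      have : (if q = 1 then X t₀ else (0 : ℝ) ^ q) = 0 := by
        split_ifs with h1
        · exact le_antisymm hle (not_lt.1 fun h => hcase ⟨h1, h⟩)
        · exact Real.zero_rpow hq0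
      simp [travelingWaveField, hmax, Real.zero_rpow hp0, this]
  have hforce : ∀ t, (if q = 1 then X t else (max (X t) 0) ^ q) = X t ^ q := by
    intro t
    split_ifs with h1
    · rw [h1, Real.rpow_one]
    · rw [max_eq_left (hpos t).le]
  obtain ⟨A1, A2⟩ := lienard_damping_comparison (F := fun x => k * x ^ n - c * x)
    (G := fun x => x ^ (p + 1) / (p + 1) - x ^ (q + 1) / (q + 1)) (by linarith) (by linarith)
    hpq hk hnpq hc (fun _ => rfl) (fun _ => rfl)
  refine false_of_periodic_lienard (F := fun x => k * x ^ n - c * x)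
    (G := fun x => x ^ (p + 1) / (p + 1) - x ^ (q + 1) / (q + 1)) (g := fun x => x ^ p - x ^ q)
    (x := X) (w := fun t => Y t + (k * X t ^ n - c * X t)) hT
    (fun x hx => (hasDerivAt_rpow_add_one_div (by linarith) hx).sub
      (hasDerivAt_rpow_add_one_div (by linarith) hx))
    (fun x hx hx1 => rpow_sub_rpow_neg hpq hx hx1) (fun x hx => rpow_sub_rpow_pos hpq hx)
    A1 A2 (fun t => by simpa using hX t) (fun t => ?_) hpos hXT
    (fun t => by simp only [hXT t, hYT t]) (fun t ht hw => ?_)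
  · have h1 := (hY t).add ((((hX t).rpow_const (p := n) (Or.inl (hpos t).ne')).const_mul k).sub
      ((hX t).const_mul c))
    refine h1.congr_deriv ?_
    rw [hforce, max_eq_left (hpos t).le]
    ring
  -- `X = 1` and `w = F 1` mean `Y = 0`, that is, the equilibrium `(1, 0)`.
  · refine hne t 1 (by simp [travelingWaveField]) (Prod.ext ht ?_)
    simp only [ht] at hw
    simpa using hw

theorem mainTheorem6 (n p q k c : ℝ) (hn : 2 ≤ n) (hq : 1 ≤ q) (hpq : q < p) (hk : 0 < k)
    (hnpq : n < p + q + 1) (hc : c ∈ Set.Ico (k * n) (k * n + 2 * Real.sqrt (p - q))) :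
    ¬ ∃ Γ : Set (ℝ × ℝ), IsLimitCycle (travelingWaveField n p q k c) Γ := by
  rintro ⟨Γ, hΓ, -⟩
  exact not_isCycle_travelingWaveField hn hq hpq hk hnpq hc.1 Γ hΓ
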